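/- Let $M$ be a matrix with non-negative real entries, with rows indexed by a set $R$ and columns by a set $C$. An \emph{EF-protocol} for $M$ is a two-party communication protocol of the following kind. Alice receives a row index $i\in R$ and Bob a column index $j\in C$; each of them has private randomness (Alice's being independent of Bob's) and unlimited computational power. The bits exchanged so far determine whose turn it is, and the player whose turn it is either sends one bit to the other player or outputs a non-negative number, which ends the round; this decision may depend only on that player's own input and private randomness and on the bits exchanged so far. The protocol is given by a finite tree, and for all $(i,j)\in R\times C$ the output $X_{ij}$ must satisfy $\mathbb{E}[X_{ij}]=M_{ij}$. The \emph{complexity} of the protocol is the maximum number of bits exchanged, over all inputs $(i,j)$ and all outcomes of the private randomness. For natural numbers $k,n$ let $N^k_n$ be the $2^n\times 2^n$ matrix with rows and columns indexed by $\{0,1\}^n$ and entries $$N^k_n(a,b)=(a^{\intercal}b-k)(a^{\intercal}b-k-1),\qquad a,b\in\{0,1\}^n .$$ \textbf{Lemma.} For $k\ge 1$, every EF-protocol for $N^k_n$ requires $\Omega(n-k)$ bits to be exchanged. That is, there is an absolute constant $\delta>0$ such that for all natural numbers $k\ge 1$ and $n$, every EF-protocol for $N^k_n$ has complexity at least $\delta\,(n-k)$.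 -/

import Mathlib

open MeasureTheory
open scoped NNReal

universe r c u v

/-- A two-party strategy (protocol tree). Alice knows her input `i : R` and her private randomness
`α : ΩA`; Bob knows his input `j : C` and his private randomness `β : ΩB`; both know the bits
exchanged so far, i.e. the current node of the tree. At a node of a player, that player (using only
its own input and randomness) either outputs a non-negative number, which ends the round, or sends
one bit to the other player, after which the round goes on at the corresponding child.
A leaf is a node at which the player has to output a number. -/
inductive Strategy (R C ΩA ΩB : Type*) [MeasurableSpace ΩA] [MeasurableSpace ΩB]
  | aliceOutputs (f : R → ΩA → ℝ≥0) (hf : ∀ i, Measurable (f i)) : Strategy R C ΩA ΩB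
  | bobOutputs (g : C → ΩB → ℝ≥0) (hg : ∀ j, Measurable (g j)) : Strategy R C ΩA ΩB
  | alice (f : R → ΩA → ℝ≥0 ⊕ Bool) (hf : ∀ i, Measurable (f i))
      (next : Bool → Strategy R C ΩA ΩB) : Strategy R C ΩA ΩB
  | bob (g : C → ΩB → ℝ≥0 ⊕ Bool) (hg : ∀ j, Measurable (g j))
      (next : Bool → Strategy R C ΩA ΩB) : Strategy R C ΩA ΩB

namespace Strategy

variable {R C ΩA ΩB : Type*} [MeasurableSpace ΩA] [MeasurableSpace ΩB]

/-- The number that is output when the inputs are `i`, `j` and the private randomness is `α`, `β`. -/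
def output : Strategy R C ΩA ΩB → R → C → ΩA → ΩB → ℝ≥0
  | aliceOutputs f _, i, _, α, _ => f i α
  | bobOutputs g _, _, j, _, β => g j β
  | alice f _ next, i, j, α, β =>
      match f i α with
      | .inl x => x
      | .inr s => (next s).output i j α β
  | bob g _ next, i, j, α, β =>
      match g j β with
      | .inl x => x
      | .inr s => (next s).output i j α β

/-- The number of bits exchanged (by both players together) when the inputs are `i`, `j` and the
private randomness is `α`, `β`. -/
def bits : Strategy R C ΩA ΩB → R → C → ΩA → ΩB → ℕ
  | aliceOutputs _ _, _, _, _, _ => 0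
  | bobOutputs _ _, _, _, _, _ => 0
  | alice f _ next, i, j, α, β =>
      match f i α with
      | .inl _ => 0
      | .inr s => (next s).bits i j α β + 1
  | bob g _ next, i, j, α, β =>
      match g j β with
      | .inl _ => 0
      | .inr s => (next s).bits i j α β + 1

/-- A strategy is a finite tree, so the number of bits exchanged is bounded. -/
theorem exists_bits_le (t : Strategy R C ΩA ΩB) : ∃ h : ℕ, ∀ i j α β, t.bits i j α β ≤ h := by
  induction t with
  | aliceOutputs f hf => exact ⟨0, fun _ _ _ _ => le_rfl⟩
  | bobOutputs g hg => exact ⟨0, fun _ _ _ _ => le_rfl⟩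
  | alice f hf next ih =>
    choose h hh using ih
    refine ⟨max (h true) (h false) + 1, fun i j α β => ?_⟩
    simp only [bits]
    rcases f i α with x | (_ | _)
    · simp
    · exact Nat.succ_le_succ ((hh false i j α β).trans (le_max_right _ _))
    · exact Nat.succ_le_succ ((hh true i j α β).trans (le_max_left _ _))
  | bob g hg next ih =>
    choose h hh using ih
    refine ⟨max (h true) (h false) + 1, fun i j α β => ?_⟩
    simp only [bits]
    rcases g j β with x | (_ | _)
    · simp
    · exact Nat.succ_le_succ ((hh false i j α β).trans (le_max_right _ _))
    · exact Nat.succ_le_succ ((hh true i j α β).trans (le_max_left _ _))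

end Strategy

/-- An EF-protocol for the matrix `M`: private sources of randomness for Alice and for Bob (arbitrary
probability spaces, independent of each other) and a strategy whose output on inputs `i`, `j` has
expected value `M i j`, for all `i`, `j`. -/
structure EFProtocol {R : Type r} {C : Type c} (M : Matrix R C ℝ) where
  ΩA : Type u
  ΩB : Type v
  [measurableSpaceA : MeasurableSpace ΩA]
  [measurableSpaceB : MeasurableSpace ΩB]
  μA : Measure ΩA
  μB : Measure ΩB
  [isProbA : IsProbabilityMeasure μA]
  [isProbB : IsProbabilityMeasure μB]
  strategy : Strategy R C ΩA ΩB
  integrable_output : ∀ i j,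
    Integrable (fun ω : ΩA × ΩB => (strategy.output i j ω.1 ω.2 : ℝ)) (μA.prod μB)
  expected_output : ∀ i j,
    ∫ ω : ΩA × ΩB, (strategy.output i j ω.1 ω.2 : ℝ) ∂(μA.prod μB) = M i j

namespace EFProtocol

variable {R : Type r} {C : Type c} {M : Matrix R C ℝ}

/-- The set of all possible numbers of bits exchanged, over all inputs and all random choices. -/
def bitCounts (P : EFProtocol.{r, c, u, v} M) : Set ℕ :=
  let _ := P.measurableSpaceA
  let _ := P.measurableSpaceB
  {m | ∃ i j α β, P.strategy.bits i j α β = m}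

/-- The complexity of an EF-protocol: the maximum number of bits exchanged. -/
noncomputable def complexity (P : EFProtocol.{r, c, u, v} M) : ℕ := sSup P.bitCounts

/-- The complexity is a genuine maximum. -/
theorem isGreatest_complexity [Nonempty R] [Nonempty C] (P : EFProtocol.{r, c, u, v} M) :
    IsGreatest P.bitCounts P.complexity := by
  let _ := P.measurableSpaceA
  let _ := P.measurableSpaceB
  have hA := P.isProbA
  have hB := P.isProbB
  obtain ⟨α⟩ := P.μA.nonempty_of_neZero
  obtain ⟨β⟩ := P.μB.nonempty_of_neZero
  obtain ⟨h, hh⟩ := P.strategy.exists_bits_le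
  have hbdd : BddAbove P.bitCounts := by
    refine ⟨h, ?_⟩
    rintro m ⟨i, j, α, β, rfl⟩
    exact hh i j α β
  have hne : P.bitCounts.Nonempty :=
    ⟨_, Classical.arbitrary R, Classical.arbitrary C, α, β, rfl⟩
  exact ⟨Nat.sSup_mem hne hbdd, fun m hm => le_csSup hbdd hm⟩

end EFProtocol

/-- The inner product `aᵀb` of two `0/1` vectors of length `n` (`true` is `1`, `false` is `0`). -/
def zeroOneDot {n : ℕ} (a b : Fin n → Bool) : ℕ := ∑ i, (a i).toNat * (b i).toNat

/-- The `2ⁿ × 2ⁿ` matrix `N^k_n`, with entries `(aᵀb - k)(aᵀb - k - 1)` for `a, b ∈ {0,1}ⁿ`. -/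
def matrixN (k n : ℕ) : Matrix (Fin n → Bool) (Fin n → Bool) ℝ :=
  fun a b => ((zeroOneDot a b : ℝ) - k) * ((zeroOneDot a b : ℝ) - k - 1)

/-! Every node of depth at most `c` contributes one product of a function of Alice's data and a
function of Bob's data to the output. By independence the expectation is a sum of fewer than `2 ^ (c
+ 1)` products of non-negative quantities. Nothing cancels, so the support of the matrix is the
union of that many rectangles (`exists_rectangle_cover`).

Fixing `k - 1` coordinates of both vectors to 1 leaves the entries `(t - 1) * (t - 2)`, where `t` is
the inner product on the other `m = n - k + 1` coordinates. The rectangles therefore cover all `3 ^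
m` disjoint pairs (`t = 0`) and avoid `t = 1`. Such a rectangle has at most `2 ^ m` disjoint pairs
(`disjointPairs_le_two_pow`), so at least `(3 / 2) ^ m` rectangles are needed. -/

namespace Strategy

variable {R C ΩA ΩB : Type*} [MeasurableSpace ΩA] [MeasurableSpace ΩB]

/-- On all inputs and random choices for which at most `c` bits are exchanged, the output of a
strategy is a sum of fewer than `2 ^ (c + 1)` products of a measurable function of Alice's data and
a measurable function of Bob's data. -/
theorem exists_output_eq_sum_mul (t : Strategy R C ΩA ΩB) (c : ℕ) :
    ∃ (ι : Type) (_ : Fintype ι) (A : ι → R → ΩA → ℝ≥0) (B : ι → C → ΩB → ℝ≥0),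
      Fintype.card ι < 2 ^ (c + 1) ∧ (∀ s i, Measurable (A s i)) ∧ (∀ s j, Measurable (B s j)) ∧
      ∀ i j α β, t.bits i j α β ≤ c → t.output i j α β = ∑ s, A s i α * B s j β := by
  classical
  have h2 : ∀ c : ℕ, 1 < 2 ^ (c + 1) := fun c => Nat.one_lt_two_pow (Nat.succ_ne_zero c)
  induction t generalizing c with
  | aliceOutputs f hf =>
    exact ⟨Unit, inferInstance, fun _ => f, fun _ _ _ => 1, h2 c, fun _ => hf,
      fun _ _ => measurable_const,
      fun i j α β _ => by simp [output]⟩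
  | bobOutputs g hg =>
    exact ⟨Unit, inferInstance, fun _ _ _ => 1, fun _ => g, h2 c, fun _ _ => measurable_const,
      fun _ => hg,
      fun i j α β _ => by simp [output]⟩
  | alice f hf next ih =>
    have hm : ∀ i, Measurable fun α => Sum.elim id (fun _ => (0 : ℝ≥0)) (f i α) := fun i =>
      (Measurable.sumElim measurable_id measurable_const).comp (hf i)
    have hs : ∀ s i, MeasurableSet {α | f i α = Sum.inr s} := fun s i =>
      hf i (MeasurableSet.singleton s).inr_image |> fun h => by
        convert h using 1
        ext α
        simp
    -- The tree may be deeper than the budget `c`. With budget 0 no bit may be sent, so the default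
    -- 0 on the sending branch is never the required output.
    cases c with
    | zero =>
      refine ⟨Unit, inferInstance, fun _ i α => Sum.elim id (fun _ => 0) (f i α), fun _ _ _ => 1,
        h2 0, fun _ => hm, fun _ _ => measurable_const, fun i j α β hb => ?_⟩
      simp only [bits, output] at hb ⊢
      cases h : f i α <;> simp [h] at hb ⊢
    | succ c =>
      obtain ⟨ι₀, _, A₀, B₀, hN₀, hA₀, hB₀, h₀⟩ := ih false c
      obtain ⟨ι₁, _, A₁, B₁, hN₁, hA₁, hB₁, h₁⟩ := ih true c
      refine ⟨Option (ι₀ ⊕ ι₁), inferInstance,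
        fun s => s.elim (fun i α => Sum.elim id (fun _ => 0) (f i α))
          (Sum.elim (fun s i α => if f i α = Sum.inr false then A₀ s i α else 0)
          (fun s i α => if f i α = Sum.inr true then A₁ s i α else 0)),
        fun s => s.elim (fun _ _ => 1) (Sum.elim B₀ B₁), ?_, ?_, ?_, ?_⟩
      -- `none` is the term for an output at this node. The strict bounds on the two children leave
      -- room for it.
      · rw [Fintype.card_option, Fintype.card_sum, pow_succ]
        omega
      · rintro (_ | s | s) i
        · exact hm i
        · exact Measurable.ite (hs false i) (hA₀ s i) measurable_const
        · exact Measurable.ite (hs true i) (hA₁ s i) measurable_const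
      · rintro (_ | s | s) j
        · exact measurable_const
        · exact hB₀ s j
        · exact hB₁ s j
      · intro i j α β hb
        simp only [bits, output] at hb ⊢
        rw [Fintype.sum_option, Fintype.sum_sum_type]
        rcases h : f i α with x | (_ | _) <;> simp only [h, Nat.add_le_add_iff_right] at hb ⊢
        · simp [h]
        · simp [h, h₀ i j α β hb]
        · simp [h, h₁ i j α β hb]
  | bob g hg next ih =>
    have hm : ∀ j, Measurable fun β => Sum.elim id (fun _ => (0 : ℝ≥0)) (g j β) := fun j =>
      (Measurable.sumElim measurable_id measurable_const).comp (hg j)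
    have hs : ∀ s j, MeasurableSet {β | g j β = Sum.inr s} := fun s j =>
      hg j (MeasurableSet.singleton s).inr_image |> fun h => by
        convert h using 1
        ext β
        simp
    cases c with
    | zero =>
      refine ⟨Unit, inferInstance, fun _ _ _ => 1, fun _ j β => Sum.elim id (fun _ => 0) (g j β),
        h2 0, fun _ _ => measurable_const, fun _ => hm, fun i j α β hb => ?_⟩
      simp only [bits, output] at hb ⊢
      cases h : g j β <;> simp [h] at hb ⊢
    | succ c =>
      obtain ⟨ι₀, _, A₀, B₀, hN₀, hA₀, hB₀, h₀⟩ := ih false c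
      obtain ⟨ι₁, _, A₁, B₁, hN₁, hA₁, hB₁, h₁⟩ := ih true c
      refine ⟨Option (ι₀ ⊕ ι₁), inferInstance,
        fun s => s.elim (fun _ _ => 1) (Sum.elim A₀ A₁),
        fun s => s.elim (fun j β => Sum.elim id (fun _ => 0) (g j β))
          (Sum.elim (fun s j β => if g j β = Sum.inr false then B₀ s j β else 0)
          (fun s j β => if g j β = Sum.inr true then B₁ s j β else 0)), ?_, ?_, ?_, ?_⟩
      · rw [Fintype.card_option, Fintype.card_sum, pow_succ]
        omega
      · rintro (_ | s | s) i
        · exact measurable_const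
        · exact hA₀ s i
        · exact hA₁ s i
      · rintro (_ | s | s) j
        · exact hm j
        · exact Measurable.ite (hs false j) (hB₀ s j) measurable_const
        · exact Measurable.ite (hs true j) (hB₁ s j) measurable_const
      · intro i j α β hb
        simp only [bits, output] at hb ⊢
        rw [Fintype.sum_option, Fintype.sum_sum_type]
        rcases h : g j β with x | (_ | _) <;> simp only [h, Nat.add_le_add_iff_right] at hb ⊢
        · simp [h]
        · simp [h, h₀ i j α β hb]
        · simp [h, h₁ i j α β hb]

end Strategy

/-- The support of a matrix with an EF-protocol of complexity `c` is a union of fewer than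
`2 ^ (c + 1)` combinatorial rectangles. -/
theorem EFProtocol.exists_rectangle_cover {R : Type r} {C : Type c} [Nonempty R] [Nonempty C]
    {M : Matrix R C ℝ} (P : EFProtocol.{r, c, u, v} M) :
    ∃ (ι : Type) (_ : Fintype ι) (X : ι → R → Prop) (Y : ι → C → Prop),
      Fintype.card ι < 2 ^ (P.complexity + 1) ∧
      ∀ i j, M i j ≠ 0 ↔ ∃ s, X s i ∧ Y s j := by
  let _ := P.measurableSpaceA
  let _ := P.measurableSpaceB
  have _ := P.isProbA
  have _ := P.isProbB
  obtain ⟨ι, _, A, B, hN, hA, hB, h⟩ := P.strategy.exists_output_eq_sum_mul P.complexity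
  refine ⟨ι, inferInstance, fun s i => ∫⁻ α, A s i α ∂P.μA ≠ 0,
    fun s j => ∫⁻ β, B s j β ∂P.μB ≠ 0, hN,
    fun i j => ?_⟩
  have hout : ∀ α β, P.strategy.output i j α β = ∑ s, A s i α * B s j β := fun α β =>
    h i j α β (P.isGreatest_complexity.2 ⟨i, j, α, β, rfl⟩)
  -- With values in `ENNReal`, the factors need not be integrable separately.
  have hl : ∫⁻ ω : ΩA P × ΩB P, (P.strategy.output i j ω.1 ω.2 : ENNReal) ∂(P.μA.prod P.μB) =
      ∑ s, (∫⁻ α, A s i α ∂P.μA) * ∫⁻ β, B s j β ∂P.μB := by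
    simp only [hout, ENNReal.ofNNReal_finsetSum, ENNReal.coe_mul]
    rw [lintegral_finsetSum]
    · refine Finset.sum_congr rfl fun s _ => ?_
      exact lintegral_prod_mul (hA s i).coe_nnreal_ennreal.aemeasurable
        (hB s j).coe_nnreal_ennreal.aemeasurable
    · intro s _
      exact ((hA s i).coe_nnreal_ennreal.comp measurable_fst).mul
        ((hB s j).coe_nnreal_ennreal.comp measurable_snd)
  have hM : ENNReal.ofReal (M i j) = ∑ s, (∫⁻ α, A s i α ∂P.μA) * ∫⁻ β, B s j β ∂P.μB := by
    rw [← P.expected_output i j, ofReal_integral_eq_lintegral_ofReal (P.integrable_output i j)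
      (Filter.Eventually.of_forall fun _ => NNReal.coe_nonneg _), ← hl]
    simp
  have h0 : 0 ≤ M i j := by
    rw [← P.expected_output i j]
    exact integral_nonneg fun _ => NNReal.coe_nonneg _
  have hpos : M i j ≠ 0 ↔ ENNReal.ofReal (M i j) ≠ 0 := by
    rw [ne_eq, ne_eq, ENNReal.ofReal_eq_zero, h0.ge_iff_eq']
  rw [hpos, hM, ne_eq, Finset.sum_eq_zero_iff]
  simp

/-! ### Counting disjoint pairs in rectangles -/

theorem zeroOneDot_cons {n : ℕ} (x y : Bool) (a b : Fin n → Bool) :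
    zeroOneDot (Fin.cons x a : Fin (n + 1) → Bool) (Fin.cons y b : Fin (n + 1) → Bool) =
      x.toNat * y.toNat + zeroOneDot a b := by
  simp [zeroOneDot, Fin.sum_univ_succ]

theorem zeroOneDot_append_true {j m : ℕ} (a b : Fin m → Bool) :
    zeroOneDot (Fin.append (fun _ : Fin j => true) a) (Fin.append (fun _ : Fin j => true) b) =
      j + zeroOneDot a b := by
  simp [zeroOneDot, Fin.sum_univ_add]

open Classical in
/-- The number of pairs of disjoint subsets (given by their indicator vectors) in the rectangle
with sides `X` and `Y`. -/
noncomputable def disjointPairs {n : ℕ} (X Y : (Fin n → Bool) → Prop) : ℕ :=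
  ∑ a, ∑ b, if X a ∧ Y b ∧ zeroOneDot a b = 0 then 1 else 0

theorem sum_cons_bool {n : ℕ} (F : (Fin (n + 1) → Bool) → ℕ) :
    ∑ a, F a = ∑ a : Fin n → Bool, (F (Fin.cons false a) + F (Fin.cons true a)) := by
  rw [← (Fin.consEquiv fun _ => Bool).sum_comp, Fintype.sum_prod_type, Fintype.sum_bool,
    ← Finset.sum_add_distrib]
  exact Finset.sum_congr rfl fun a _ => add_comm _ _

theorem disjointPairs_true (n : ℕ) :
    disjointPairs (fun _ : Fin n → Bool => True) (fun _ => True) = 3 ^ n := by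
  induction n with
  | zero => simp [disjointPairs, zeroOneDot]
  | succ n ih =>
    rw [pow_succ, ← ih]
    simp only [disjointPairs, sum_cons_bool, zeroOneDot_cons, Finset.sum_mul]
    refine Finset.sum_congr rfl fun a _ => ?_
    rw [← Finset.sum_add_distrib]
    refine Finset.sum_congr rfl fun b _ => ?_
    simp
    split_ifs <;> rfl

/-- A rectangle that contains no pair of sets meeting in exactly one point contains at most `2 ^ n`
pairs of disjoint sets. -/
theorem disjointPairs_le_two_pow {n : ℕ} (X Y : (Fin n → Bool) → Prop)
    (h : ∀ a b, X a → Y b → zeroOneDot a b ≠ 1) : disjointPairs X Y ≤ 2 ^ n := by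
  induction n with
  | zero =>
    simp only [disjointPairs, Fintype.sum_unique]
    split_ifs <;> simp
  | succ n ih =>
    -- Split off one coordinate. In both smaller rectangles one side comes from vectors with 0
    -- there, so that coordinate adds nothing to the inner product and 1 is still avoided.
    have h₁ := ih (fun a => X (Fin.cons false a) ∨ X (Fin.cons true a))
      (fun b => Y (Fin.cons false b)) (by
        rintro a b (ha | ha) hb <;> simpa [zeroOneDot_cons] using h _ _ ha hb)
    have h₂ := ih (fun a => X (Fin.cons false a))
      (fun b => Y (Fin.cons false b) ∨ Y (Fin.cons true b)) (by
        rintro a b ha (hb | hb) <;> simpa [zeroOneDot_cons] using h _ _ ha hb)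
    rw [pow_succ, mul_two]
    refine le_trans ?_ (add_le_add h₁ h₂)
    simp only [disjointPairs, sum_cons_bool, zeroOneDot_cons, ← Finset.sum_add_distrib]
    refine Finset.sum_le_sum fun a _ => Finset.sum_le_sum fun b _ => ?_
    by_cases hab : zeroOneDot a b = 0
    -- The disjoint extensions of `(a, b)` are `(0, 0)`, `(1, 0)`, `(0, 1)`. All three could occur
    -- only if `(1, 1)`, with inner product 1, did too; so at most two occur, and the two smaller
    -- rectangles account for them.
    · have h11 : X (Fin.cons true a) → ¬ Y (Fin.cons true b) := fun ha hb =>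
        h _ _ ha hb (by simp [zeroOneDot_cons, hab])
      by_cases hx₀ : X (Fin.cons false a) <;> by_cases hx₁ : X (Fin.cons true a) <;>
      by_cases hy₀ : Y (Fin.cons false b) <;> by_cases hy₁ : Y (Fin.cons true b) <;>
      simp_all [zeroOneDot_cons]
    · simp [zeroOneDot_cons, hab]

/-- A cover of all pairs of disjoint sets by rectangles without pairs of sets meeting in exactly one
point has at least `(3 / 2) ^ n` members. -/
theorem three_pow_le_mul_of_rectangle_cover {n : ℕ} {ι : Type*} [Fintype ι]
    (X Y : ι → (Fin n → Bool) → Prop)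
    (hcover : ∀ a b, zeroOneDot a b = 0 → ∃ s, X s a ∧ Y s b)
    (havoid : ∀ s a b, X s a → Y s b → zeroOneDot a b ≠ 1) : 3 ^ n ≤ Fintype.card ι * 2 ^ n := by
  classical
  calc 3 ^ n = disjointPairs (fun _ : Fin n → Bool => True) (fun _ => True) :=
        (disjointPairs_true n).symm
    _ ≤ ∑ s, disjointPairs (X s) (Y s) := by
        simp only [disjointPairs]
        rw [Finset.sum_comm (s := (Finset.univ : Finset ι))]
        refine Finset.sum_le_sum fun a _ => ?_
        rw [Finset.sum_comm (s := (Finset.univ : Finset ι))]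
        refine Finset.sum_le_sum fun b _ => ?_
        by_cases hab : zeroOneDot a b = 0
        · obtain ⟨s, hX, hY⟩ := hcover a b hab
          simp only [hab, and_true, if_true, Finset.sum_boole]
          exact Finset.card_pos.2 ⟨s, by simp [hX, hY]⟩
        · simp [hab]
    _ ≤ ∑ _s : ι, 2 ^ n :=
        Finset.sum_le_sum fun s _ => disjointPairs_le_two_pow _ _ (havoid s)
    _ = Fintype.card ι * 2 ^ n := by simp

/-- Two factors `3 / 2` give `9 / 4 > 2`, so each factor 2 in `N` pays for at most two coordinates.
-/
theorem le_two_mul_add_one_of_three_pow_le {m N c : ℕ} (h : 3 ^ m ≤ N * 2 ^ m)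
    (hN : N < 2 ^ (c + 1)) : m ≤ 2 * c + 1 := by
  by_contra! hm
  obtain ⟨d, rfl⟩ := Nat.exists_eq_add_of_lt hm
  have h1 : N * 2 ^ (2 * c + 1 + d + 1) < 2 ^ (c + 1) * 2 ^ (2 * c + 1 + d + 1) :=
    Nat.mul_lt_mul_of_pos_right hN (by positivity)
  have h2 : 2 ^ (c + 1) * 2 ^ (2 * c + 1 + d + 1) = 8 ^ (c + 1) * 2 ^ d := by
    rw [show (8 : ℕ) = 2 ^ 3 by norm_num, ← pow_mul, ← pow_add, ← pow_add]
    congr 1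
    ring
  have h3 : 3 ^ (2 * c + 1 + d + 1) = 9 ^ (c + 1) * 3 ^ d := by
    rw [show (9 : ℕ) = 3 ^ 2 by norm_num, ← pow_mul, ← pow_add]
    congr 1
    ring
  have h4 : 8 ^ (c + 1) * 2 ^ d ≤ 9 ^ (c + 1) * 3 ^ d := by gcongr <;> norm_num
  omega

theorem mainTheorem10 :
    ∃ δ : ℝ, 0 < δ ∧ ∀ k n : ℕ, 1 ≤ k →
      ∀ P : EFProtocol.{0, 0, u, v} (matrixN k n), δ * ((n : ℝ) - (k : ℝ)) ≤ (P.complexity : ℝ) := by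
  refine ⟨1 / 2, by norm_num, fun k n hk P => ?_⟩
  rcases lt_or_ge n k with hnk | hnk
  · have : (n : ℝ) < k := by exact_mod_cast hnk
    have : (0 : ℝ) ≤ P.complexity := Nat.cast_nonneg _
    linarith
  -- Here `k = j + 1` and `n = j + m`, so `n - k = m - 1`; the bound `m ≤ 2 * c + 1` then gives
  -- exactly `δ = 1 / 2`.
  obtain ⟨j, rfl⟩ := Nat.exists_eq_add_of_le' hk
  obtain ⟨m, rfl⟩ := Nat.exists_eq_add_of_le (Nat.le_of_succ_le hnk)
  obtain ⟨ι, _, X, Y, hN, hXY⟩ := P.exists_rectangle_cover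
  have hentry : ∀ a b : Fin m → Bool,
      matrixN (j + 1) (j + m) (Fin.append (fun _ => true) a) (Fin.append (fun _ => true) b) =
        ((zeroOneDot a b : ℝ) - 1) * ((zeroOneDot a b : ℝ) - 2) := fun a b => by
    simp only [matrixN, zeroOneDot_append_true]
    push_cast
    ring
  have h3 : 3 ^ m ≤ Fintype.card ι * 2 ^ m := three_pow_le_mul_of_rectangle_cover
    (fun s a => X s (Fin.append (fun _ => true) a)) (fun s b => Y s (Fin.append (fun _ => true) b))
    (fun a b hab => (hXY _ _).1 (by rw [hentry, hab]; norm_num))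
    (fun s a b ha hb hab => (hXY _ _).2 ⟨s, ha, hb⟩ (by rw [hentry, hab]; norm_num))
  have hm : (m : ℝ) ≤ 2 * P.complexity + 1 := by
    exact_mod_cast le_two_mul_add_one_of_three_pow_le h3 hN
  push_cast
  linarith
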